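/- Let $\mathbb F=\mathbb R$ or $\mathbb C$, let $\mathrm{Sym}_n=\mathrm{Sym}_n(\mathbb F)$ be the real vector space of $n\times n$ real symmetric (respectively complex Hermitian) matrices, and let $\widehat\lambda_1(A)\le\dots\le\widehat\lambda_n(A)$ be the eigenvalues of $A\in\mathrm{Sym}_n$, repeated according to multiplicity. Let $M$ be a smooth ($C^\infty$) $d$-dimensional manifold, $\mathcal F:M\to\mathrm{Sym}_n$ a smooth map, $1\le k\le n$, and $\lambda_k:=\widehat\lambda_k\circ\mathcal F$. The multiplicity of $\lambda_k$ at a point $y\in M$ is the dimension of the eigenspace of $\mathcal F(y)$ for the eigenvalue $\lambda_k(y)$. Let $x\in M$ be a point where $\lambda_k$ has multiplicity $\nu\ge 1$, and let $U:\mathbb F^\nu\to\mathbb F^n$ be a linear isometry onto the eigenspace of $\mathcal F(x)$ for the eigenvalue $\lambda_k(x)$. Define the linear operator $$\mathcal H_x:T_xM\to\mathrm{Sym}_\nu,\qquad \mathcal H_x v=U^*\big(d\mathcal F(x)v\big)U .$$ Assume that the non-degenerate criticality condition (N) holds at $x$: the orthogonal complement of $\operatorname{Ran}\mathcal H_x$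 in $\mathrm{Sym}_\nu$, with respect to the Frobenius inner product $\langle X,Y\rangle=\operatorname{Tr}(XY)$, is the real line spanned by a positive definite matrix $B\in\mathrm{Sym}_\nu$ (this does not depend on the choice of $U$). Then there is a smooth embedded submanifold $S\subset M$ such that for all $y$ in some neighborhood of $x$ in $M$, the multiplicity of $\lambda_k$ at $y$ equals $\nu$ if and only if $y\in S$ (in particular $x\in S$), and such that: 1. $S$ has codimension $s(\nu):=\dim_{\mathbb R}\mathrm{Sym}_\nu(\mathbb F)-1$ in $M$; 2. the restriction $\lambda_k|_S$ is a smooth function on $S$ with a critical point at $x$, i.e. $d(\lambda_k|_S)(x)=0$. -/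

import Mathlib

open scoped Manifold ContDiff Matrix Topology ComplexOrder

noncomputable section

namespace EigStratum

/-- The real vector space of `n × n` self-adjoint matrices over `𝕜` (real symmetric for `𝕜 = ℝ`,
complex Hermitian for `𝕜 = ℂ`), normed below by the Frobenius norm. -/
def Sym (𝕜 : Type*) [RCLike 𝕜] (n : ℕ) : Type _ :=
  ↥(selfAdjoint.submodule ℝ (Matrix (Fin n) (Fin n) 𝕜))

variable {𝕜 : Type*} [RCLike 𝕜] {n : ℕ}

open scoped Matrix.Norms.Frobenius in
instance : NormedAddCommGroup (Sym 𝕜 n) :=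
  inferInstanceAs (NormedAddCommGroup ↥(selfAdjoint.submodule ℝ (Matrix (Fin n) (Fin n) 𝕜)))

open scoped Matrix.Norms.Frobenius in
instance : NormedSpace ℝ (Sym 𝕜 n) :=
  inferInstanceAs (NormedSpace ℝ ↥(selfAdjoint.submodule ℝ (Matrix (Fin n) (Fin n) 𝕜)))

/-- The inclusion of the self-adjoint matrices into all matrices. -/
def Sym.toMatrix : Sym 𝕜 n →ₗ[ℝ] Matrix (Fin n) (Fin n) 𝕜 :=
  (selfAdjoint.submodule ℝ (Matrix (Fin n) (Fin n) 𝕜)).subtype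

theorem Sym.isHermitian (A : Sym 𝕜 n) : (Sym.toMatrix A).IsHermitian :=
  A.2

/-- The `k`-th eigenvalue of `A`, in increasing order with multiplicity; indices start at `0`.
(Mathlib's `eigenvalues₀` is in decreasing order.) -/
def eigval (k : Fin n) (A : Sym 𝕜 n) : ℝ :=
  A.isHermitian.eigenvalues₀ (Fin.cast (Fintype.card_fin n).symm k.rev)

/-- The eigenspace of `A` belonging to its `k`-th eigenvalue. -/
def eigspace (k : Fin n) (A : Sym 𝕜 n) : Submodule 𝕜 (Fin n → 𝕜) :=
  Module.End.eigenspace (Matrix.toLin' A.toMatrix) ((eigval k A : ℝ) : 𝕜)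

/-- The multiplicity of the `k`-th eigenvalue of `A`. -/
def eigmult (k : Fin n) (A : Sym 𝕜 n) : ℕ :=
  Module.finrank 𝕜 (eigspace k A)

/-- The columns of `U` form an orthonormal basis of `E`; that is, `U` is a linear isometry
`𝕜^ν → 𝕜^n` with range `E`. -/
def IsIsometryOnto {ν : ℕ} (U : Matrix (Fin n) (Fin ν) 𝕜) (E : Submodule 𝕜 (Fin n → 𝕜)) : Prop :=
  Uᴴ * U = 1 ∧ LinearMap.range U.mulVecLin = E

/-- The compression `X ↦ U* X U`. -/
def compression {ν : ℕ} (U : Matrix (Fin n) (Fin ν) 𝕜) : Sym 𝕜 n →ₗ[ℝ] Sym 𝕜 ν where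
  toFun X := ⟨Uᴴ * X.toMatrix * U, Matrix.isHermitian_conjTranspose_mul_mul U X.isHermitian⟩
  map_add' X Y := by
    apply Subtype.ext
    change Uᴴ * (X + Y).toMatrix * U = Uᴴ * X.toMatrix * U + Uᴴ * Y.toMatrix * U
    rw [map_add, Matrix.mul_add, Matrix.add_mul]
  map_smul' c X := by
    apply Subtype.ext
    change Uᴴ * (c • X).toMatrix * U = c • (Uᴴ * X.toMatrix * U)
    rw [map_smul, Matrix.mul_smul, Matrix.smul_mul]

/-- The orthogonal complement in `Sym 𝕜 ν` for the Frobenius inner product `⟨X, Y⟩ = Tr (X Y)`. -/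
def frobeniusPerp {ν : ℕ} (V : Submodule ℝ (Sym 𝕜 ν)) : Submodule ℝ (Sym 𝕜 ν) where
  carrier := {Y | ∀ X ∈ V, Matrix.trace (X.toMatrix * Y.toMatrix) = 0}
  add_mem' {Y Z} hY hZ X hX := by
    rw [map_add, Matrix.mul_add, Matrix.trace_add, hY X hX, hZ X hX, add_zero]
  zero_mem' X _ := by rw [map_zero, Matrix.mul_zero, Matrix.trace_zero]
  smul_mem' c Y hY X hX := by
    rw [map_smul, Matrix.mul_smul, Matrix.trace_smul, hY X hX, smul_zero]

/-- `s(ν) = dim Sym_ν(𝕜) - 1`, the dimension being the real one (it is positive for `ν ≥ 1`). -/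
def stratumCodim (𝕜 : Type*) [RCLike 𝕜] (ν : ℕ) : ℕ :=
  Module.finrank ℝ (Sym 𝕜 ν) - 1

variable {d : ℕ} {M : Type*} [TopologicalSpace M] [ChartedSpace (EuclideanSpace ℝ (Fin d)) M]

/-- The operator `v ↦ U* (dF(x) v) U` from `T_x M` to `Sym_ν`. -/
def compressedDeriv {ν : ℕ} (F : M → Sym 𝕜 n) (x : M) (U : Matrix (Fin n) (Fin ν) 𝕜) :
    TangentSpace (𝓡 d) x →ₗ[ℝ] Sym 𝕜 ν :=
  compression U ∘ₗ (mfderiv (𝓡 d) 𝓘(ℝ, Sym 𝕜 n) F x).toLinearMap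

/-- The non-degenerate criticality condition (N) at `x` for the `k`-th eigenvalue of `F`, which has
multiplicity `ν` at `x`: the orthogonal complement of the range of `v ↦ U* (dF(x) v) U` is spanned
by a positive definite matrix, where `U` is an isometry onto the eigenspace at `x`. (Another choice
of `U` changes everything by a unitary conjugation, so the choice does not matter.) -/
def ConditionN (F : M → Sym 𝕜 n) (k : Fin n) (ν : ℕ) (x : M) : Prop :=
  ∃ U : Matrix (Fin n) (Fin ν) 𝕜, IsIsometryOnto U (eigspace k (F x)) ∧
    ∃ B : Sym 𝕜 ν, B.toMatrix.PosDef ∧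
      frobeniusPerp (LinearMap.range (compressedDeriv (d := d) F x U)) = Submodule.span ℝ {B}

end EigStratum

end

noncomputable section

/-! Write `A₀ = F x` and `t₀ = λ_k(x)`. For `(A, t)` near `(A₀, t₀)`, eliminating the block of `A -
t` on the complement of the eigenspace leaves a Schur complement `R(A, t)` in `Sym_ν`, and `t` is an
eigenvalue of `A` of multiplicity `ν` exactly when `R(A, t) = 0` (`reduced_eq_zero_iff`). At `(A₀,
t₀)` the differential of `R` is `(X, s) ↦ U* X U - s` (`hasFDerivAt_reduced`).

Since `Tr B > 0`, the scalar equation `Tr(B R(A, t)) = 0` can be solved for `t = μ(A)` with `μ`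
smooth. The remaining equation is `Ψ(A) = R(A, μ(A)) = 0`, where `Ψ` takes values in the hyperplane
orthogonal to `B`; on its zero set `λ_k` equals `μ`, by continuity of the ordered eigenvalues
(`exists_local_equation`).

Condition (N) says that the range of `H_x` is exactly that hyperplane. As `dμ(X) = Tr(B U* X U) / Tr
B`, it follows that `d(μ ∘ F)(x) = 0`, which is the criticality. Hence `d(Ψ ∘ F)(x) = H_x` is onto
the hyperplane, and the regular level set theorem (`exists_isSmoothEmbedding_zeroSet`) gives `S`
with codimension `dim Sym_ν - 1`. -/

/-! ### Weyl's inequality for ordered eigenvalues. -/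

theorem OrthonormalBasis.norm_sq_eq_sum_repr {𝕜 E ι : Type*} [RCLike 𝕜]
    [NormedAddCommGroup E] [InnerProductSpace 𝕜 E] [Fintype ι] (b : OrthonormalBasis ι 𝕜 E)
    (v : E) : ‖v‖ ^ 2 = ∑ j, ‖b.repr v j‖ ^ 2 := by
  rw [← b.repr.norm_map, EuclideanSpace.norm_sq_eq]

namespace LinearMap.IsSymmetric

variable {𝕜 E : Type*} [RCLike 𝕜] [NormedAddCommGroup E] [InnerProductSpace 𝕜 E]
  [FiniteDimensional 𝕜 E] {n : ℕ}

theorem re_inner_apply_self_eq_sum {T : E →ₗ[𝕜] E} (hT : T.IsSymmetric)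
    (hn : Module.finrank 𝕜 E = n) (v : E) :
    RCLike.re (inner 𝕜 v (T v)) =
      ∑ j, hT.eigenvalues hn j * ‖(hT.eigenvectorBasis hn).repr v j‖ ^ 2 := by
  rw [← (hT.eigenvectorBasis hn).repr.inner_map_map, PiLp.inner_apply, map_sum]
  refine Finset.sum_congr rfl fun j _ => ?_
  rw [hT.eigenvectorBasis_apply_self_apply hn, ← smul_eq_mul, inner_smul_right,
    inner_self_eq_norm_sq_to_K, ← RCLike.ofReal_pow, ← RCLike.ofReal_mul, RCLike.ofReal_re]

/-- Weyl's monotonicity inequality: if the quadratic form of `S` exceeds that of `T` by at most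
`C ‖v‖ ^ 2`, then each ordered eigenvalue of `S` exceeds that of `T` by at most `C`. -/
theorem eigenvalues_le_add {S T : E →ₗ[𝕜] E} (hS : S.IsSymmetric) (hT : T.IsSymmetric)
    (hn : Module.finrank 𝕜 E = n) (C : ℝ)
    (h : ∀ v, RCLike.re (inner 𝕜 v (S v)) ≤ RCLike.re (inner 𝕜 v (T v)) + C * ‖v‖ ^ 2)
    (i : Fin n) : hS.eigenvalues hn i ≤ hT.eigenvalues hn i + C := by
  classical
  -- These are `n - 1` linear conditions on an `n`-dimensional space. A nonzero solution lies in the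
  -- span of the eigenvectors of `S` with index at most `i` and of those of `T` with index at least
  -- `i`; as eigenvalues decrease with the index, its two Rayleigh quotients bound the `i`-th
  -- eigenvalues.
  let f : E →ₗ[𝕜] ({j : Fin n // j ≠ i} → 𝕜) := LinearMap.pi fun j =>
    if i < j then
      LinearMap.proj j.1 ∘ₗ (WithLp.linearEquiv 2 𝕜 (Fin n → 𝕜)).toLinearMap ∘ₗ
        (hS.eigenvectorBasis hn).repr.toLinearEquiv.toLinearMap
    else
      LinearMap.proj j.1 ∘ₗ (WithLp.linearEquiv 2 𝕜 (Fin n → 𝕜)).toLinearMap ∘ₗ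
        (hT.eigenvectorBasis hn).repr.toLinearEquiv.toLinearMap
  have hf : LinearMap.ker f ≠ ⊥ := by
    apply LinearMap.ker_ne_bot_of_finrank_lt
    have := i.pos
    simp only [Module.finrank_fintype_fun_eq_card, hn, Fintype.card_subtype_compl,
      Fintype.card_fin, Fintype.card_unique]
    lia
  obtain ⟨v, hv, hv0⟩ := Submodule.exists_mem_ne_zero_of_ne_bot hf
  have hSv (j : Fin n) (hj : i < j) : (hS.eigenvectorBasis hn).repr v j = 0 := by
    have := congrFun (LinearMap.mem_ker.1 hv) ⟨j, hj.ne'⟩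
    simpa [f, hj] using this
  have hTv (j : Fin n) (hj : j < i) : (hT.eigenvectorBasis hn).repr v j = 0 := by
    have := congrFun (LinearMap.mem_ker.1 hv) ⟨j, hj.ne⟩
    simpa [f, hj.not_gt] using this
  have h1 : hS.eigenvalues hn i * ‖v‖ ^ 2 ≤ RCLike.re (inner 𝕜 v (S v)) := by
    rw [hS.re_inner_apply_self_eq_sum hn, (hS.eigenvectorBasis hn).norm_sq_eq_sum_repr,
      Finset.mul_sum]
    refine Finset.sum_le_sum fun j _ => ?_
    rcases lt_or_ge i j with hj | hj
    · simp [hSv j hj]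
    · exact mul_le_mul_of_nonneg_right (hS.eigenvalues_antitone hn hj) (by positivity)
  have h2 : RCLike.re (inner 𝕜 v (T v)) ≤ hT.eigenvalues hn i * ‖v‖ ^ 2 := by
    rw [hT.re_inner_apply_self_eq_sum hn, (hT.eigenvectorBasis hn).norm_sq_eq_sum_repr,
      Finset.mul_sum]
    refine Finset.sum_le_sum fun j _ => ?_
    rcases lt_or_ge j i with hj | hj
    · simp [hTv j hj]
    · exact mul_le_mul_of_nonneg_right (hT.eigenvalues_antitone hn hj) (by positivity)
  have hpos : 0 < ‖v‖ ^ 2 := by positivity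
  refine le_of_mul_le_mul_right ?_ hpos
  linarith [h v]

end LinearMap.IsSymmetric

/-! ### Continuity of eigenvalues and counting of multiplicities. -/

namespace EigStratum

variable {𝕜 : Type*} [RCLike 𝕜] {n : ℕ}

instance : FiniteDimensional ℝ (Sym 𝕜 n) :=
  inferInstanceAs (FiniteDimensional ℝ ↥(selfAdjoint.submodule ℝ (Matrix (Fin n) (Fin n) 𝕜)))

theorem Sym.toMatrix_injective : Function.Injective (Sym.toMatrix : Sym 𝕜 n →ₗ[ℝ] _) :=
  Subtype.val_injective

/-- The operator on Euclidean space with matrix `A`. -/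
def Sym.toCLM : Sym 𝕜 n →ₗ[ℝ] EuclideanSpace 𝕜 (Fin n) →L[𝕜] EuclideanSpace 𝕜 (Fin n) :=
  (Matrix.toEuclideanCLM (n := Fin n) (𝕜 := 𝕜)).toAlgEquiv.toLinearMap.restrictScalars ℝ ∘ₗ
    Sym.toMatrix

theorem Sym.toCLM_apply (A : Sym 𝕜 n) (v : EuclideanSpace 𝕜 (Fin n)) :
    Sym.toCLM A v = Matrix.toEuclideanLin A.toMatrix v := rfl

theorem Sym.continuous_toCLM : Continuous (Sym.toCLM : Sym 𝕜 n →ₗ[ℝ] _) :=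
  LinearMap.continuous_of_finiteDimensional _

theorem eigval_le_add_norm (k : Fin n) (A B : Sym 𝕜 n) :
    eigval k A ≤ eigval k B + ‖Sym.toCLM A - Sym.toCLM B‖ := by
  refine LinearMap.IsSymmetric.eigenvalues_le_add _ _ _ _ (fun v => ?_) _
  rw [← Sym.toCLM_apply, ← Sym.toCLM_apply, ← sub_le_iff_le_add', ← map_sub, ← inner_sub_right,
    ← sub_apply]
  calc _ ≤ ‖v‖ * ‖(Sym.toCLM A - Sym.toCLM B) v‖ := re_inner_le_norm _ _
    _ ≤ ‖v‖ * (‖Sym.toCLM A - Sym.toCLM B‖ * ‖v‖) := by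
      gcongr; exact ContinuousLinearMap.le_opNorm _ _
    _ = _ := by ring

theorem continuous_eigval (k : Fin n) : Continuous (eigval k : Sym 𝕜 n → ℝ) := by
  rw [continuous_iff_continuousAt]
  intro A
  rw [ContinuousAt, tendsto_iff_dist_tendsto_zero]
  have h : Filter.Tendsto (fun B : Sym 𝕜 n => ‖Sym.toCLM B - Sym.toCLM A‖) (𝓝 A) (𝓝 0) := by
    have := (Sym.continuous_toCLM (𝕜 := 𝕜) (n := n)).tendsto A
    exact tendsto_iff_norm_sub_tendsto_zero.1 this
  refine squeeze_zero (fun _ => dist_nonneg) (fun B => ?_) h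
  rw [Real.dist_eq, abs_sub_le_iff]
  constructor
  · linarith [eigval_le_add_norm k B A]
  · rw [norm_sub_rev]
    linarith [eigval_le_add_norm k A B]

theorem finrank_eigenspace_eq_card (A : Sym 𝕜 n) (μ : ℝ) :
    Module.finrank 𝕜 (Module.End.eigenspace (Matrix.toLin' A.toMatrix) (μ : 𝕜)) =
      Finset.card {i : Fin n | eigval i A = μ} := by
  have h := (Matrix.isSymmetric_toEuclideanLin_iff.mpr A.isHermitian).card_filter_eigenvalues_eq
    finrank_euclideanSpace (μ : 𝕜)
  have h1 : Module.finrank 𝕜 (Module.End.eigenspace (Matrix.toLin' A.toMatrix) (μ : 𝕜)) =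
      Module.finrank 𝕜 (Module.End.eigenspace (Matrix.toEuclideanLin A.toMatrix) (μ : 𝕜)) := by
    refine LinearEquiv.finrank_eq
      ((WithLp.linearEquiv 2 𝕜 (Fin n → 𝕜)).symm.ofSubmodules _ _ ?_)
    ext v
    simp only [Submodule.mem_map_equiv, LinearEquiv.symm_symm, Module.End.mem_eigenspace_iff]
    rw [← (WithLp.linearEquiv 2 𝕜 (Fin n → 𝕜)).injective.eq_iff]
    rfl
  rw [h1, ← h]
  -- The reversal of indices turns the increasing order of `eigval` into the decreasing one of
  -- `eigenvalues₀`.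
  refine (Finset.card_bij (fun i _ => Fin.cast (Fintype.card_fin n).symm i.rev) ?_ ?_ ?_).symm
  · intro i hi
    have hi' : eigval i A = μ := (Finset.mem_filter.1 hi).2
    exact Finset.mem_filter.2 ⟨Finset.mem_univ _, congrArg _ hi'⟩
  · intro i _ j _ hij
    simpa using hij
  · intro j hj
    refine ⟨(Fin.cast (Fintype.card_fin n) j).rev, Finset.mem_filter.2 ⟨Finset.mem_univ _, ?_⟩,
      by simp⟩
    have hjμ := RCLike.ofReal_injective (Finset.mem_filter.1 hj).2
    rw [eigval, Fin.rev_rev]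
    exact hjμ

/-- Near `A₀`, an eigenvalue close to the `k`-th eigenvalue of `A₀` and of the same multiplicity
is the `k`-th eigenvalue. -/
theorem eventually_eigval_eq_of_finrank_eigenspace_eq (k : Fin n) (A₀ : Sym 𝕜 n) :
    ∀ᶠ p : Sym 𝕜 n × ℝ in 𝓝 (A₀, eigval k A₀),
      Module.finrank 𝕜 (Module.End.eigenspace (Matrix.toLin' p.1.toMatrix) (p.2 : 𝕜)) =
        eigmult k A₀ → eigval k p.1 = p.2 := by
  have h : ∀ i : Fin n, ∀ᶠ p : Sym 𝕜 n × ℝ in 𝓝 (A₀, eigval k A₀),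
      eigval i p.1 = p.2 → eigval i A₀ = eigval k A₀ := by
    intro i
    by_cases hi : eigval i A₀ = eigval k A₀
    · exact Filter.Eventually.of_forall fun _ _ => hi
    · have h1 : ContinuousAt (fun p : Sym 𝕜 n × ℝ => eigval i p.1) (A₀, eigval k A₀) :=
        ((continuous_eigval i).comp continuous_fst).continuousAt
      filter_upwards [(h1.ne_iff_eventually_ne continuous_snd.continuousAt).1 hi] with p hp hp'
      exact absurd hp' hp
  filter_upwards [Filter.eventually_all.2 h] with p hp hfin
  rw [eigmult, eigspace, finrank_eigenspace_eq_card, finrank_eigenspace_eq_card] at hfin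
  -- Only eigenvalues from the cluster of the `k`-th one at `A₀` can equal `p.2`. Equal
  -- cardinalities then force the whole cluster, hence the index `k`, to do so.
  have hsub : (Finset.univ.filter fun i : Fin n => eigval i p.1 = p.2) ⊆
      Finset.univ.filter fun i : Fin n => eigval i A₀ = eigval k A₀ := by
    intro i hi
    simp only [Finset.mem_filter, Finset.mem_univ, true_and] at hi ⊢
    exact hp i hi
  have hk : k ∈ Finset.univ.filter fun i : Fin n => eigval i p.1 = p.2 := by
    rw [Finset.eq_of_subset_of_card_le hsub hfin.ge]
    simp
  simpa using hk

end EigStratum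

/-! ### Algebra of the Schur complement. -/

namespace EigStratum

variable {𝕜 : Type*} [RCLike 𝕜] {n ν : ℕ}

/-- The orthogonal projection onto the complement of the range of the isometry `U`. -/
def complProj (U : Matrix (Fin n) (Fin ν) 𝕜) : Matrix (Fin n) (Fin n) 𝕜 := 1 - U * Uᴴ

/-- The compression of `L` to the complement of the range of `U`, extended by the identity on the
range of `U`. -/
def complBlock (U : Matrix (Fin n) (Fin ν) 𝕜) (L : Matrix (Fin n) (Fin n) 𝕜) :
    Matrix (Fin n) (Fin n) 𝕜 :=
  complProj U * L * complProj U + U * Uᴴ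

/-- The Schur complement of the block of `L` on the complement of the range of `U`, as an
`n × n` matrix. -/
def schurCompl (U : Matrix (Fin n) (Fin ν) 𝕜) (L : Matrix (Fin n) (Fin n) 𝕜) :
    Matrix (Fin n) (Fin n) 𝕜 :=
  L - L * (complProj U * Ring.inverse (complBlock U L) * complProj U) * L

section Algebra

variable {U : Matrix (Fin n) (Fin ν) 𝕜} {L : Matrix (Fin n) (Fin n) 𝕜}

theorem complProj_mul (hU : Uᴴ * U = 1) : complProj U * U = 0 := by
  rw [complProj, Matrix.sub_mul, Matrix.mul_assoc, hU, Matrix.one_mul, Matrix.mul_one, sub_self]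

theorem mul_complProj (hU : Uᴴ * U = 1) : Uᴴ * complProj U = 0 := by
  rw [complProj, Matrix.mul_sub, ← Matrix.mul_assoc, hU, Matrix.one_mul, Matrix.mul_one, sub_self]

theorem complProj_mul_self (hU : Uᴴ * U = 1) : complProj U * complProj U = complProj U := by
  rw [show complProj U * complProj U = 1 * complProj U - U * Uᴴ * complProj U from
    sub_mul _ _ _, Matrix.mul_assoc, mul_complProj hU, Matrix.mul_zero, one_mul, sub_zero]

theorem isHermitian_complProj : (complProj U).IsHermitian := by
  simp [complProj, Matrix.IsHermitian]

theorem complBlock_mul_complProj (hU : Uᴴ * U = 1) :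
    complBlock U L * complProj U = complProj U * L * complProj U := by
  rw [complBlock, add_mul, mul_assoc, complProj_mul_self hU, Matrix.mul_assoc U,
    mul_complProj hU, Matrix.mul_zero, add_zero]

theorem complProj_mul_complBlock (hU : Uᴴ * U = 1) :
    complProj U * complBlock U L = complProj U * L * complProj U := by
  rw [complBlock, mul_add, ← mul_assoc, ← mul_assoc, complProj_mul_self hU, ← Matrix.mul_assoc,
    complProj_mul hU, Matrix.zero_mul, add_zero]

theorem inverse_block_mul_complProj (hU : Uᴴ * U = 1) (hL : IsUnit (complBlock U L)) :
    complProj U * Ring.inverse (complBlock U L) * complProj U * L * complProj U =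
      complProj U := by
  rw [mul_assoc, mul_assoc _ (complProj U), ← mul_assoc (complProj U) L,
    ← complBlock_mul_complProj hU, mul_assoc, ← mul_assoc (Ring.inverse _),
    Ring.inverse_mul_cancel _ hL, one_mul, complProj_mul_self hU]

theorem complProj_mul_inverse_block (hU : Uᴴ * U = 1) (hL : IsUnit (complBlock U L)) :
    complProj U * (L * (complProj U * Ring.inverse (complBlock U L) * complProj U)) =
      complProj U := by
  rw [← mul_assoc, ← mul_assoc, ← mul_assoc, ← complProj_mul_complBlock hU,
    mul_assoc (complProj U), Ring.mul_inverse_cancel _ hL, mul_one, complProj_mul_self hU]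

/-- The sandwiched inverse inverts the complementary block of `L`, so elimination clears that block
and the off-diagonal ones. With `complProj_mul_schurCompl`, the Schur complement lives on the range
of `U` alone. -/
theorem schurCompl_mul_complProj (hU : Uᴴ * U = 1) (hL : IsUnit (complBlock U L)) :
    schurCompl U L * complProj U = 0 := by
  rw [schurCompl, sub_mul, mul_assoc L, mul_assoc L, inverse_block_mul_complProj hU hL, sub_self]

theorem complProj_mul_schurCompl (hU : Uᴴ * U = 1) (hL : IsUnit (complBlock U L)) :
    complProj U * schurCompl U L = 0 := by
  rw [schurCompl, mul_sub, ← mul_assoc, complProj_mul_inverse_block hU hL, sub_self]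

/-- With `R` the inverse of the complementary block, `v ↦ U* v` and `u ↦ U u - R L U u` inject each
kernel into the other: a kernel vector of `L` is determined by its component along the range of `U`.
-/
theorem finrank_ker_eq_finrank_ker_schurCompl (hU : Uᴴ * U = 1) (hL : IsUnit (complBlock U L)) :
    Module.finrank 𝕜 (LinearMap.ker L.mulVecLin) =
      Module.finrank 𝕜 (LinearMap.ker (Uᴴ * schurCompl U L * U).mulVecLin) := by
  have hPQ : U * Uᴴ = 1 - complProj U := by simp [complProj]
  set R := complProj U * Ring.inverse (complBlock U L) * complProj U with hR
  have hUR : Uᴴ * R = 0 := by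
    rw [hR, ← Matrix.mul_assoc, ← Matrix.mul_assoc, mul_complProj hU]; simp
  have hS : schurCompl U L = L - L * R * L := rfl
  have hRLQ : R * L * complProj U = complProj U := inverse_block_mul_complProj hU hL
  apply le_antisymm
  · have hmem : ∀ v ∈ LinearMap.ker L.mulVecLin,
        Uᴴ.mulVecLin v ∈ LinearMap.ker (Uᴴ * schurCompl U L * U).mulVecLin := by
      intro v hv
      simp only [LinearMap.mem_ker, Matrix.mulVecLin_apply] at hv ⊢
      rw [Matrix.mulVec_mulVec, Matrix.mul_assoc, Matrix.mul_assoc, hPQ, mul_sub, mul_one,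
        schurCompl_mul_complProj hU hL, sub_zero, hS, ← Matrix.mulVec_mulVec, Matrix.sub_mulVec,
        ← Matrix.mulVec_mulVec, hv]
      simp
    refine LinearMap.finrank_le_finrank_of_injective (f := Uᴴ.mulVecLin.restrict hmem) ?_
    rw [injective_iff_map_eq_zero]
    rintro ⟨v, hv⟩ hv0
    have h0 : Uᴴ *ᵥ v = 0 := congrArg Subtype.val hv0
    have hv' : L *ᵥ v = 0 := hv
    have h1 : complProj U *ᵥ v = v := by
      rw [complProj, Matrix.sub_mulVec, ← Matrix.mulVec_mulVec, h0]; simp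
    apply Subtype.ext
    change v = 0
    rw [← h1, ← hRLQ, ← Matrix.mulVec_mulVec, h1, ← Matrix.mulVec_mulVec, hv']
    simp
  · have hmem : ∀ u ∈ LinearMap.ker (Uᴴ * schurCompl U L * U).mulVecLin,
        (U - R * L * U).mulVecLin u ∈ LinearMap.ker L.mulVecLin := by
      intro u hu
      simp only [LinearMap.mem_ker, Matrix.mulVecLin_apply] at hu ⊢
      have : L * (U - R * L * U) = U * (Uᴴ * schurCompl U L * U) := by
        rw [← Matrix.mul_assoc, ← Matrix.mul_assoc, hPQ, sub_mul, complProj_mul_schurCompl hU hL,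
          sub_zero, one_mul, hS, Matrix.mul_sub, Matrix.sub_mul, ← Matrix.mul_assoc,
          ← Matrix.mul_assoc]
      rw [Matrix.mulVec_mulVec, this, ← Matrix.mulVec_mulVec, hu]
      simp
    refine LinearMap.finrank_le_finrank_of_injective
      (f := (U - R * L * U).mulVecLin.restrict hmem) ?_
    rw [injective_iff_map_eq_zero]
    rintro ⟨u, hu⟩ hu0
    have h0 : (U - R * L * U) *ᵥ u = 0 := congrArg Subtype.val hu0
    apply Subtype.ext
    change u = 0
    have h1 : Uᴴ * (U - R * L * U) = 1 := by
      rw [Matrix.mul_sub, hU, ← Matrix.mul_assoc, ← Matrix.mul_assoc, hUR]; simp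
    rw [← Matrix.one_mulVec u, ← h1, ← Matrix.mulVec_mulVec, h0]
    simp

/-- A `ν × ν` matrix has a `ν`-dimensional kernel only if it is zero. -/
theorem finrank_ker_eq_iff_schurCompl (hU : Uᴴ * U = 1) (hL : IsUnit (complBlock U L)) :
    Module.finrank 𝕜 (LinearMap.ker L.mulVecLin) = ν ↔ Uᴴ * schurCompl U L * U = 0 := by
  rw [finrank_ker_eq_finrank_ker_schurCompl hU hL]
  constructor
  · intro h
    have h1 : LinearMap.ker (Uᴴ * schurCompl U L * U).mulVecLin = ⊤ :=
      Submodule.eq_top_of_finrank_eq (by simpa using h)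
    rw [LinearMap.ker_eq_top] at h1
    exact Matrix.toLin'.injective (h1.trans (map_zero Matrix.toLin').symm)
  · intro h
    have h1 : LinearMap.ker (Uᴴ * schurCompl U L * U).mulVecLin = ⊤ := by
      rw [h, Matrix.mulVecLin_zero, LinearMap.ker_zero]
    rw [h1, finrank_top, Module.finrank_fin_fun]

theorem isHermitian_schurCompl (hL : L.IsHermitian) : (schurCompl U L).IsHermitian := by
  have hQ : (complProj U)ᴴ = complProj U := isHermitian_complProj
  have hL' : Lᴴ = L := hL
  have hD : (complBlock U L)ᴴ = complBlock U L := by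
    simp [complBlock, hQ, hL', mul_assoc]
  have hI : (Ring.inverse (complBlock U L))ᴴ = Ring.inverse (complBlock U L) := by
    rw [← Matrix.star_eq_conjTranspose, ← Ring.inverse_star, Matrix.star_eq_conjTranspose, hD]
  simp [Matrix.IsHermitian, schurCompl, hQ, hL', hI, mul_assoc]

/-- Here `L U = 0` and `U* L = 0`, so the block is `L + U U*`. A vector it kills has `U* v = 0`,
hence `L v = 0`, and so lies in the range of `U` while being orthogonal to it. -/
theorem isUnit_complBlock (hU : Uᴴ * U = 1) (hL : L.IsHermitian)
    (hr : LinearMap.range U.mulVecLin = LinearMap.ker L.mulVecLin) :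
    IsUnit (complBlock U L) := by
  have hLU : L * U = 0 := by
    refine Matrix.toLin'.injective (LinearMap.ext fun u => ?_)
    have : U *ᵥ u ∈ LinearMap.ker L.mulVecLin := hr ▸ ⟨u, rfl⟩
    simpa using this
  have hUL : Uᴴ * L = 0 := by
    have := congrArg Matrix.conjTranspose hLU
    rwa [Matrix.conjTranspose_mul, hL.eq, Matrix.conjTranspose_zero] at this
  have hD : complBlock U L = L + U * Uᴴ := by
    rw [complBlock, complProj, sub_mul, one_mul, Matrix.mul_assoc, hUL, Matrix.mul_zero, sub_zero,
      mul_sub, mul_one, ← Matrix.mul_assoc, hLU, Matrix.zero_mul, sub_zero]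
  rw [hD, ← Matrix.mulVec_injective_iff_isUnit]
  have : Function.Injective (L + U * Uᴴ).mulVecLin := by
    rw [injective_iff_map_eq_zero]
    intro v hv
    rw [Matrix.mulVecLin_apply] at hv
    have h1 : Uᴴ *ᵥ v = 0 := by
      have := congrArg (Uᴴ *ᵥ ·) hv
      simpa only [Matrix.mulVec_mulVec, Matrix.mul_add, hUL, zero_add, ← Matrix.mul_assoc, hU,
        Matrix.one_mul, Matrix.mulVec_zero] using this
    rw [Matrix.add_mulVec, ← Matrix.mulVec_mulVec, h1, Matrix.mulVec_zero, add_zero] at hv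
    have h2 : v ∈ LinearMap.range U.mulVecLin := hr ▸ hv
    obtain ⟨u, rfl⟩ := h2
    rw [Matrix.mulVecLin_apply, Matrix.mulVec_mulVec, hU, Matrix.one_mulVec] at h1
    rw [h1, map_zero]
  exact this

end Algebra

end EigStratum

/-! ### Inverse and implicit functions, smooth on open sets. -/

section InverseFunction

variable {E F : Type*} [NormedAddCommGroup E] [NormedSpace ℝ E] [CompleteSpace E]
  [NormedAddCommGroup F] [NormedSpace ℝ F]

/-- The inverse function theorem for smooth maps, with smoothness of the map and of its inverse on
whole neighbourhoods. -/
theorem ContDiffOn.exists_openPartialHomeomorph {f : E → F} {O : Set E} (hO : IsOpen O)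
    (hf : ContDiffOn ℝ ∞ f O) {a : E} (ha : a ∈ O) {f' : E ≃L[ℝ] F}
    (hf' : HasFDerivAt f (f' : E →L[ℝ] F) a) :
    ∃ e : OpenPartialHomeomorph E F, a ∈ e.source ∧ e.source ⊆ O ∧ (e : E → F) = f ∧
      ContDiffOn ℝ ∞ e e.source ∧ ContDiffOn ℝ ∞ e.symm e.target := by
  have hfa : ∀ x ∈ O, ContDiffAt ℝ ∞ f x := fun x hx => hf.contDiffAt (hO.mem_nhds hx)
  let e₀ := (hfa a ha).toOpenPartialHomeomorph f hf' (by simp)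
  have he₀ : (e₀ : E → F) = f := rfl
  -- Invertibility of the derivative is an open condition; restricting to it makes the inverse
  -- smooth at every point of the target.
  let W : Set E := O ∩ fderiv ℝ f ⁻¹' Set.range ((↑) : (E ≃L[ℝ] F) → E →L[ℝ] F)
  have hcont : ContinuousOn (fderiv ℝ f) O := hf.continuousOn_fderiv_of_isOpen hO (by simp)
  have hW : IsOpen W := hcont.isOpen_inter_preimage hO ContinuousLinearEquiv.isOpen
  have haW : a ∈ W := ⟨ha, f', hf'.fderiv.symm⟩
  have hsub : (e₀.restrOpen W hW).source ⊆ W := by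
    rw [OpenPartialHomeomorph.restrOpen_source]; exact Set.inter_subset_right
  refine ⟨e₀.restrOpen W hW, ?_, hsub.trans Set.inter_subset_left, he₀, ?_, ?_⟩
  · rw [OpenPartialHomeomorph.restrOpen_source]
    exact ⟨ContDiffAt.mem_toOpenPartialHomeomorph_source _ _ _, haW⟩
  · exact hf.mono (hsub.trans Set.inter_subset_left)
  · intro y hy
    have hx := hsub ((e₀.restrOpen W hW).map_target hy)
    obtain ⟨g, hg⟩ := hx.2
    refine ((e₀.restrOpen W hW).contDiffAt_symm (f₀' := g) hy ?_ ?_).contDiffWithinAt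
    · rw [hg]
      exact ((hfa _ hx.1).differentiableAt (by simp)).hasFDerivAt
    · exact hfa _ hx.1

/-- A scalar implicit function theorem with smoothness on a whole neighbourhood. -/
theorem ContDiffOn.exists_implicitFunction_real {g : E × ℝ → ℝ} {O : Set (E × ℝ)} (hO : IsOpen O)
    (hg : ContDiffOn ℝ ∞ g O) {a : E} {t : ℝ} (ha : (a, t) ∈ O) (h0 : g (a, t) = 0)
    {g' : E × ℝ →L[ℝ] ℝ} (hg' : HasFDerivAt g g' (a, t)) (hne : g' (0, 1) ≠ 0) :
    ∃ (W : Set E) (μ : E → ℝ), IsOpen W ∧ a ∈ W ∧ ContDiffOn ℝ ∞ μ W ∧ μ a = t ∧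
      (∀ x ∈ W, (x, μ x) ∈ O ∧ g (x, μ x) = 0) ∧
      (∀ᶠ p : E × ℝ in 𝓝 (a, t), g p = 0 → p.2 = μ p.1) ∧
      HasFDerivAt μ (-(g' (0, 1))⁻¹ • g' ∘L ContinuousLinearMap.inl ℝ E ℝ) a := by
  have hlin : ∀ p : E × ℝ, g' p = g' (p.1, 0) + p.2 * g' (0, 1) := fun p => by
    rw [← smul_eq_mul, ← map_smul, ← map_add]; simp
  -- The derivative of `(x, s) ↦ (x, g (x, s))`; the implicit function is the second coordinate of
  -- the local inverse along the slice `(x, 0)`.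
  let Θ : (E × ℝ) ≃L[ℝ] (E × ℝ) := ContinuousLinearEquiv.equivOfInverse
    ((ContinuousLinearMap.fst ℝ E ℝ).prod g')
    ((ContinuousLinearMap.fst ℝ E ℝ).prod ((g' (0, 1))⁻¹ • (ContinuousLinearMap.snd ℝ E ℝ -
      g' ∘L ContinuousLinearMap.inl ℝ E ℝ ∘L ContinuousLinearMap.fst ℝ E ℝ)))
    (fun p => by
      ext
      · simp
      · simp [hlin p]; field_simp)
    (fun p => by
      ext
      · simp
      · simp only [ContinuousLinearMap.prod_apply, ContinuousLinearMap.coe_fst']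
        rw [hlin]
        simp; field_simp; ring)
  have hΘ : HasFDerivAt (fun p : E × ℝ => (p.1, g p)) (Θ : E × ℝ →L[ℝ] E × ℝ) (a, t) :=
    hasFDerivAt_fst.prodMk hg'
  obtain ⟨e, hae, heO, hef, -, hes⟩ :=
    (contDiffOn_fst.prodMk hg).exists_openPartialHomeomorph hO ha hΘ
  have hfix : ∀ x s, (x, s) ∈ e.target → (e.symm (x, s)).1 = x := fun x s h => by
    have := e.right_inv h
    rw [hef] at this
    exact congrArg Prod.fst this
  let ι : E → E × ℝ := fun x => (x, 0)
  have hι : ContDiff ℝ ∞ ι := contDiff_id.prodMk contDiff_const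
  have hea : e (a, t) = (a, 0) := by rw [hef]; simp [h0]
  have hat : (a, (0 : ℝ)) ∈ e.target := hea ▸ e.map_source hae
  have hsa : e.symm (a, 0) = (a, t) := by rw [← hea, e.left_inv hae]
  have hsmooth : ContDiffOn ℝ ∞ (fun x => (e.symm (ι x)).2) (ι ⁻¹' e.target) :=
    contDiff_snd.comp_contDiffOn (hes.comp hι.contDiffOn fun x hx => hx)
  have hopen : IsOpen (ι ⁻¹' e.target) := e.open_target.preimage hι.continuous
  have hsol : ∀ x ∈ ι ⁻¹' e.target,
      (x, (e.symm (ι x)).2) ∈ O ∧ g (x, (e.symm (ι x)).2) = 0 := by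
    intro x hx
    have hpair : (x, (e.symm (ι x)).2) = e.symm (ι x) := Prod.ext (hfix x 0 hx).symm rfl
    rw [hpair]
    refine ⟨heO (e.map_target hx), ?_⟩
    have := e.right_inv hx
    rw [hef] at this
    exact congrArg Prod.snd this
  refine ⟨ι ⁻¹' e.target, fun x => (e.symm (ι x)).2, hopen, hat, hsmooth, ?_, hsol, ?_, ?_⟩
  · exact congrArg Prod.snd hsa
  · filter_upwards [e.open_source.mem_nhds hae] with p hp hgp
    have h1 : e p = ι p.1 := by rw [hef]; simp [hgp, ι]
    simp only [← h1, e.left_inv hp]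
  · have hd : DifferentiableAt ℝ (fun x => (e.symm (ι x)).2) a :=
      (hsmooth.contDiffAt (hopen.mem_nhds hat)).differentiableAt (by simp)
    set μ := fun x => (e.symm (ι x)).2 with hμ
    have hμa : μ a = t := congrArg Prod.snd hsa
    -- Differentiating the identity `g (x, μ x) = 0` determines the derivative of `μ`.
    have hc : HasFDerivAt (fun x => g (x, μ x))
        (g' ∘L (ContinuousLinearMap.id ℝ E).prod (fderiv ℝ μ a)) a := by
      have hg'' : HasFDerivAt g g' (a, μ a) := by rwa [hμa]
      exact hg''.comp a ((hasFDerivAt_id a).prodMk hd.hasFDerivAt)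
    have hz : HasFDerivAt (fun x => g (x, μ x)) (0 : E →L[ℝ] ℝ) a := by
      refine (hasFDerivAt_const (0 : ℝ) a).congr_of_eventuallyEq ?_
      filter_upwards [hopen.mem_nhds hat] with x hx
      exact (hsol x hx).2
    convert hd.hasFDerivAt using 1
    ext v
    have := DFunLike.congr_fun (hc.unique hz) v
    simp only [ContinuousLinearMap.comp_apply, ContinuousLinearMap.prod_apply,
      zero_apply] at this
    rw [hlin] at this
    simp at this ⊢
    field_simp
    linarith

end InverseFunction

/-! ### The trace form and the reduced equation. -/

namespace EigStratum

variable {𝕜 : Type*} [RCLike 𝕜] {n ν : ℕ}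

/-- The identity matrix as a self-adjoint matrix. -/
def Sym.one : Sym 𝕜 ν := ⟨1, Matrix.isHermitian_one⟩

theorem Sym.toMatrix_one : (Sym.one : Sym 𝕜 ν).toMatrix = 1 := rfl

/-- The trace form `(X, Y) ↦ Tr (X Y)` on self-adjoint matrices. -/
def traceForm : LinearMap.BilinForm ℝ (Sym 𝕜 ν) :=
  LinearMap.mk₂ ℝ (fun X Y => RCLike.re (Matrix.trace (X.toMatrix * Y.toMatrix)))
    (fun X X' Y => by simp [Matrix.add_mul]) (fun c X Y => by simp [RCLike.smul_re])
    (fun X Y Y' => by simp [Matrix.mul_add]) (fun c X Y => by simp [RCLike.smul_re])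

theorem traceForm_apply (X Y : Sym 𝕜 ν) :
    traceForm X Y = RCLike.re (Matrix.trace (X.toMatrix * Y.toMatrix)) := rfl

/-- Conjugating `Tr(XY)` gives `Tr(YX)`, so it is real and the real part in `traceForm` loses
nothing. -/
theorem coe_traceForm (X Y : Sym 𝕜 ν) :
    ((traceForm X Y : ℝ) : 𝕜) = Matrix.trace (X.toMatrix * Y.toMatrix) := by
  rw [traceForm_apply, ← RCLike.conj_eq_iff_re, starRingEnd_apply, ← Matrix.trace_conjTranspose,
    Matrix.conjTranspose_mul, X.isHermitian.eq, Y.isHermitian.eq, Matrix.trace_mul_comm]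

theorem traceForm_eq_zero_iff (X Y : Sym 𝕜 ν) :
    traceForm X Y = 0 ↔ Matrix.trace (X.toMatrix * Y.toMatrix) = 0 := by
  rw [← coe_traceForm, RCLike.ofReal_eq_zero]

theorem traceForm_comm (X Y : Sym 𝕜 ν) : traceForm X Y = traceForm Y X := by
  rw [traceForm_apply, traceForm_apply, Matrix.trace_mul_comm]

theorem traceForm_isRefl : (traceForm : LinearMap.BilinForm ℝ (Sym 𝕜 ν)).IsRefl :=
  fun X Y h => (traceForm_comm Y X).trans h

theorem traceForm_nondegenerate :
    (traceForm : LinearMap.BilinForm ℝ (Sym 𝕜 ν)).Nondegenerate := by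
  have h : ∀ X : Sym 𝕜 ν, traceForm X X = 0 → X = 0 := fun X hX => by
    rw [traceForm_eq_zero_iff] at hX
    nth_rewrite 1 [← X.isHermitian.eq] at hX
    rw [Matrix.trace_conjTranspose_mul_self_eq_zero_iff] at hX
    exact Sym.toMatrix_injective (hX.trans (map_zero _).symm)
  exact ⟨fun X hX => h X (hX X), fun X hX => h X (hX X)⟩

theorem frobeniusPerp_eq_orthogonal (V : Submodule ℝ (Sym 𝕜 ν)) :
    frobeniusPerp V = traceForm.orthogonal V := by
  ext Y
  exact forall₂_congr fun X _ => (traceForm_eq_zero_iff X Y).symm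

/-- Positivity of `B` enters through this inequality: it makes the `t`-derivative of the scalar
equation nonzero. -/
theorem traceForm_one_pos (hν : 0 < ν) {B : Sym 𝕜 ν} (hB : B.toMatrix.PosDef) :
    0 < traceForm Sym.one B := by
  have : Nonempty (Fin ν) := ⟨⟨0, hν⟩⟩
  rw [traceForm_apply, Sym.toMatrix_one, Matrix.one_mul]
  exact (RCLike.pos_iff.1 hB.trace_pos).1

/-- Compression followed by taking the self-adjoint part, on all matrices. -/
def compressionPart (U : Matrix (Fin n) (Fin ν) 𝕜) :
    Matrix (Fin n) (Fin n) 𝕜 →ₗ[ℝ] Sym 𝕜 ν where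
  toFun X := selfAdjointPart ℝ (Uᴴ * X * U)
  map_add' X Y := by rw [Matrix.mul_add, Matrix.add_mul, map_add]; rfl
  map_smul' c X := by rw [Matrix.mul_smul, Matrix.smul_mul, map_smul]; rfl

theorem compressionPart_apply (U : Matrix (Fin n) (Fin ν) 𝕜) (X : Matrix (Fin n) (Fin n) 𝕜) :
    compressionPart U X = selfAdjointPart ℝ (Uᴴ * X * U) := rfl

/-- The self-adjoint part serves only to have a linear map into `Sym` on all matrices, so that
smoothness can be checked on matrix products; Hermitian inputs are unaffected. -/
theorem toMatrix_compressionPart (U : Matrix (Fin n) (Fin ν) 𝕜) {X : Matrix (Fin n) (Fin n) 𝕜}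
    (hX : X.IsHermitian) : (compressionPart U X).toMatrix = Uᴴ * X * U :=
  IsSelfAdjoint.coe_selfAdjointPart_apply ℝ (Matrix.isHermitian_conjTranspose_mul_mul U hX)

theorem compressionPart_toMatrix (U : Matrix (Fin n) (Fin ν) 𝕜) (X : Sym 𝕜 n) :
    compressionPart U X.toMatrix = compression U X :=
  Sym.toMatrix_injective (toMatrix_compressionPart U X.isHermitian)

theorem compression_one {U : Matrix (Fin n) (Fin ν) 𝕜} (hU : Uᴴ * U = 1) :
    compression U Sym.one = Sym.one := by
  apply Sym.toMatrix_injective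
  change Uᴴ * (1 : Matrix (Fin n) (Fin n) 𝕜) * U = 1
  rw [Matrix.mul_one, hU]

/-- `(A, t) ↦ A - t`. -/
def shift : Sym 𝕜 n × ℝ →ₗ[ℝ] Sym 𝕜 n :=
  LinearMap.fst ℝ _ _ - (LinearMap.snd ℝ _ _).smulRight Sym.one

theorem shift_apply (p : Sym 𝕜 n × ℝ) : shift p = p.1 - p.2 • Sym.one := rfl

theorem toMatrix_shift (p : Sym 𝕜 n × ℝ) : (shift p).toMatrix = p.1.toMatrix - p.2 • 1 := by
  rw [shift_apply, map_sub, map_smul, Sym.toMatrix_one]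

theorem ker_toMatrix_shift (A : Sym 𝕜 n) (t : ℝ) :
    LinearMap.ker (shift (A, t)).toMatrix.mulVecLin =
      Module.End.eigenspace (Matrix.toLin' A.toMatrix) (t : 𝕜) := by
  ext v
  rw [LinearMap.mem_ker, Module.End.mem_eigenspace_iff, Matrix.mulVecLin_apply, toMatrix_shift,
    Matrix.sub_mulVec, sub_eq_zero, Matrix.smul_mulVec, Matrix.one_mulVec, Matrix.toLin'_apply,
    RCLike.real_smul_eq_coe_smul (K := 𝕜)]

/-- The `ν × ν` Schur complement of `A - t`. -/
def reduced (U : Matrix (Fin n) (Fin ν) 𝕜) (p : Sym 𝕜 n × ℝ) : Sym 𝕜 ν :=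
  compressionPart U (schurCompl U (shift p).toMatrix)

theorem reduced_eq_zero_iff {U : Matrix (Fin n) (Fin ν) 𝕜} (hU : Uᴴ * U = 1) {p : Sym 𝕜 n × ℝ}
    (hp : IsUnit (complBlock U (shift p).toMatrix)) :
    reduced U p = 0 ↔ Module.finrank 𝕜
      (Module.End.eigenspace (Matrix.toLin' p.1.toMatrix) (p.2 : 𝕜)) = ν := by
  rw [← ker_toMatrix_shift, finrank_ker_eq_iff_schurCompl hU hp,
    ← toMatrix_compressionPart U (isHermitian_schurCompl (shift p).isHermitian)]
  exact (map_eq_zero_iff _ Sym.toMatrix_injective).symm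

section Smooth

open scoped Matrix.Norms.Frobenius

theorem contDiff_complBlock_shift (U : Matrix (Fin n) (Fin ν) 𝕜) :
    ContDiff ℝ ∞ (fun p : Sym 𝕜 n × ℝ => complBlock U (shift p).toMatrix) := by
  have h : ContDiff ℝ ∞ (fun p : Sym 𝕜 n × ℝ => (shift p).toMatrix) :=
    (Sym.toMatrix ∘ₗ shift : Sym 𝕜 n × ℝ →ₗ[ℝ] _).toContinuousLinearMap.contDiff
  exact ((contDiff_const.mul h).mul contDiff_const).add contDiff_const

theorem isOpen_isUnit_complBlock (U : Matrix (Fin n) (Fin ν) 𝕜) :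
    IsOpen {p : Sym 𝕜 n × ℝ | IsUnit (complBlock U (shift p).toMatrix)} := by
  have : CompleteSpace (Matrix (Fin n) (Fin n) 𝕜) := FiniteDimensional.complete ℝ _
  exact Units.isOpen.preimage (contDiff_complBlock_shift U).continuous

theorem contDiffAt_inverse_complBlock (U : Matrix (Fin n) (Fin ν) 𝕜) {p : Sym 𝕜 n × ℝ}
    (hp : IsUnit (complBlock U (shift p).toMatrix)) :
    ContDiffAt ℝ ∞ (fun p : Sym 𝕜 n × ℝ =>
      complProj U * Ring.inverse (complBlock U (shift p).toMatrix) * complProj U) p := by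
  have : CompleteSpace (Matrix (Fin n) (Fin n) 𝕜) := FiniteDimensional.complete ℝ _
  have hi : ContDiffAt ℝ ∞ Ring.inverse (complBlock U (shift p).toMatrix) :=
    contDiffAt_ringInverse ℝ hp.unit
  have h2 := hi.comp p (contDiff_complBlock_shift U).contDiffAt
  exact (contDiffAt_const.mul h2).mul contDiffAt_const

theorem contDiffOn_reduced (U : Matrix (Fin n) (Fin ν) 𝕜) :
    ContDiffOn ℝ ∞ (reduced U) {p | IsUnit (complBlock U (shift p).toMatrix)} := by
  intro p hp
  have h : ContDiffAt ℝ ∞ (fun p : Sym 𝕜 n × ℝ => (shift p).toMatrix) p :=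
    (Sym.toMatrix ∘ₗ shift : Sym 𝕜 n × ℝ →ₗ[ℝ] _).toContinuousLinearMap.contDiff.contDiffAt
  exact ((compressionPart U).toContinuousLinearMap.contDiff.contDiffAt.comp p
    (h.sub ((h.mul (contDiffAt_inverse_complBlock U hp)).mul h))).contDiffWithinAt

/-- The correction term is quadratic in `L = shift p`. Each term of its derivative keeps an
undifferentiated `L` at an outer end, where `U* L = 0` or `L U = 0` kills it. -/
theorem hasFDerivAt_reduced {U : Matrix (Fin n) (Fin ν) 𝕜} {p : Sym 𝕜 n × ℝ}
    (hp : IsUnit (complBlock U (shift p).toMatrix)) (hpU : (shift p).toMatrix * U = 0) :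
    HasFDerivAt (reduced U) (compression U ∘ₗ shift).toContinuousLinearMap p := by
  have hUp : Uᴴ * (shift p).toMatrix = 0 := by
    have := congrArg Matrix.conjTranspose hpU
    rwa [Matrix.conjTranspose_mul, (shift p).isHermitian.eq, Matrix.conjTranspose_zero] at this
  have h : HasFDerivAt (fun p : Sym 𝕜 n × ℝ => (shift p).toMatrix)
      (Sym.toMatrix ∘ₗ shift : Sym 𝕜 n × ℝ →ₗ[ℝ] _).toContinuousLinearMap p :=
    (Sym.toMatrix ∘ₗ shift : Sym 𝕜 n × ℝ →ₗ[ℝ] _).toContinuousLinearMap.hasFDerivAt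
  have hR := ((contDiffAt_inverse_complBlock U hp).differentiableAt (by simp)).hasFDerivAt
  have key : HasFDerivAt (reduced U) _ p :=
    (compressionPart U).toContinuousLinearMap.hasFDerivAt.comp p (h.sub ((h.mul' hR).mul' h))
  refine key.congr_fderiv ?_
  refine ContinuousLinearMap.ext fun q => ?_
  have hz : ∀ X : Matrix (Fin n) (Fin n) 𝕜, Uᴴ * X * U = 0 → compressionPart U X = 0 :=
    fun X hX => by rw [compressionPart_apply, hX, map_zero]; rfl
  set R := complProj U * Ring.inverse (complBlock U (shift p).toMatrix) * complProj U
  set R' := fderiv ℝ (fun p : Sym 𝕜 n × ℝ =>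
    complProj U * Ring.inverse (complBlock U (shift p).toMatrix) * complProj U) p
  change compressionPart U ((shift q).toMatrix - ((shift p).toMatrix * R * (shift q).toMatrix +
    ((shift p).toMatrix * R' q + (shift q).toMatrix * R) * (shift p).toMatrix)) =
      compression U (shift q)
  rw [← compressionPart_toMatrix, ← sub_eq_zero, ← map_sub]
  apply hz
  rw [sub_sub_cancel_left, Matrix.mul_neg, Matrix.neg_mul, neg_eq_zero, Matrix.mul_add,
    Matrix.add_mul, ← Matrix.mul_assoc, ← Matrix.mul_assoc, hUp,
    Matrix.mul_assoc Uᴴ, Matrix.mul_assoc _ (shift p).toMatrix U, hpU]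
  simp

end Smooth

end EigStratum

/-! ### Local equations of the stratum in the space of matrices. -/

namespace EigStratum

variable {𝕜 : Type*} [RCLike 𝕜] {n ν : ℕ}

theorem eigmult_pos (k : Fin n) (A : Sym 𝕜 n) : 0 < eigmult k A := by
  rw [eigmult, eigspace, finrank_eigenspace_eq_card, Finset.card_pos]
  exact ⟨k, by simp⟩

/-- Near `A₀` the matrices whose `k`-th eigenvalue has the same multiplicity as at `A₀` are the
zeros of a smooth map into the trace-orthogonal complement of `B`, and on them the `k`-th
eigenvalue agrees with a smooth function. -/
theorem exists_local_equation (k : Fin n) (A₀ : Sym 𝕜 n) (hν : eigmult k A₀ = ν)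
    {U : Matrix (Fin n) (Fin ν) 𝕜} (hU : IsIsometryOnto U (eigspace k A₀))
    {B : Sym 𝕜 ν} (hB : B.toMatrix.PosDef) :
    ∃ (O : Set (Sym 𝕜 n)) (μ : Sym 𝕜 n → ℝ) (Ψ : Sym 𝕜 n → Sym 𝕜 ν)
      (μ' : Sym 𝕜 n →L[ℝ] ℝ) (Ψ' : Sym 𝕜 n →L[ℝ] Sym 𝕜 ν),
      IsOpen O ∧ A₀ ∈ O ∧ ContDiffOn ℝ ∞ μ O ∧ ContDiffOn ℝ ∞ Ψ O ∧
      HasFDerivAt μ μ' A₀ ∧ HasFDerivAt Ψ Ψ' A₀ ∧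
      (∀ X, μ' X = (traceForm Sym.one B)⁻¹ * traceForm (compression U X) B) ∧
      (∀ X, Ψ' X = compression U X - μ' X • Sym.one) ∧
      ∀ A ∈ O, traceForm (Ψ A) B = 0 ∧ (eigmult k A = ν ↔ Ψ A = 0) ∧
        (Ψ A = 0 → eigval k A = μ A) := by
  have hBpos := traceForm_one_pos (hν ▸ eigmult_pos k A₀) hB
  let p₀ : Sym 𝕜 n × ℝ := (A₀, eigval k A₀)
  have hker : LinearMap.range U.mulVecLin = LinearMap.ker (shift p₀).toMatrix.mulVecLin := by
    rw [hU.2, ker_toMatrix_shift]; rfl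
  have hunit : IsUnit (complBlock U (shift p₀).toMatrix) :=
    isUnit_complBlock hU.1 (shift p₀).isHermitian hker
  have hzero : (shift p₀).toMatrix * U = 0 := by
    refine Matrix.toLin'.injective (LinearMap.ext fun u => ?_)
    have : U *ᵥ u ∈ LinearMap.ker (shift p₀).toMatrix.mulVecLin := hker ▸ ⟨u, rfl⟩
    simpa using this
  have hder := hasFDerivAt_reduced hunit hzero
  let β : Sym 𝕜 ν →L[ℝ] ℝ := (traceForm.flip B).toContinuousLinearMap
  have hβ : ∀ X, β X = traceForm X B := fun _ => rfl
  have hred₀ : reduced U p₀ = 0 := (reduced_eq_zero_iff hU.1 hunit).2 hν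
  have hshift : compression U (shift ((0 : Sym 𝕜 n), (1 : ℝ))) = -Sym.one := by
    rw [shift_apply]
    simp only [one_smul, zero_sub, map_neg, compression_one hU.1]
  -- The component of the reduced equation along `B` is solved for `t`; its `t`-derivative is `-Tr
  -- B`.
  obtain ⟨W, μ, hWo, hAW, hμW, hμ₀, hsol, huniq, hμ'⟩ :=
    (β.contDiff.comp_contDiffOn (contDiffOn_reduced U)).exists_implicitFunction_real
      (isOpen_isUnit_complBlock U) (a := A₀) (t := eigval k A₀) hunit
      ((congrArg β hred₀).trans (map_zero β))
      (β.hasFDerivAt.comp p₀ hder) (by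
        change β (compression U (shift ((0 : Sym 𝕜 n), (1 : ℝ)))) ≠ 0
        rw [hshift, map_neg, hβ]
        exact neg_ne_zero.2 hBpos.ne')
  have hμcont : ContinuousAt (fun A => (A, μ A)) A₀ :=
    continuousAt_id.prodMk (hμW.continuousOn.continuousAt (hWo.mem_nhds hAW))
  have hecont : ContinuousAt (fun A => (A, eigval k A)) A₀ :=
    continuousAt_id.prodMk (continuous_eigval k).continuousAt
  -- `h1` shows that `μ A`, when an eigenvalue of the right multiplicity, is the `k`-th one.
  -- Conversely, `h2` and `h3` show that a `k`-th eigenvalue of multiplicity `ν` must be `μ A`, by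
  -- uniqueness of the implicit function.
  have h1 : ∀ᶠ A in 𝓝 A₀, Module.finrank 𝕜 (Module.End.eigenspace (Matrix.toLin' A.toMatrix)
      ((μ A : ℝ) : 𝕜)) = eigmult k A₀ → eigval k A = μ A := by
    refine hμcont.eventually (p := fun p : Sym 𝕜 n × ℝ => Module.finrank 𝕜
      (Module.End.eigenspace (Matrix.toLin' p.1.toMatrix) (p.2 : 𝕜)) = eigmult k A₀ →
        eigval k p.1 = p.2) ?_
    simp only [hμ₀]
    exact eventually_eigval_eq_of_finrank_eigenspace_eq k A₀
  have h2 := hecont.eventually huniq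
  have h3 : ∀ᶠ A in 𝓝 A₀, IsUnit (complBlock U (shift (A, eigval k A)).toMatrix) :=
    hecont.eventually ((isOpen_isUnit_complBlock U).mem_nhds hunit)
  obtain ⟨O, hO, hOo, hAO⟩ := eventually_nhds_iff.1
    (((h1.and h2).and h3).and (hWo.mem_nhds hAW))
  have hμd : HasFDerivAt (fun A => (A, μ A)) _ A₀ := (hasFDerivAt_id A₀).prodMk hμ'
  have hΨ' : HasFDerivAt (fun A => reduced U (A, μ A)) _ A₀ :=
    HasFDerivAt.comp (g := reduced U) (f := fun A => (A, μ A)) A₀ (by rwa [hμ₀]) hμd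
  refine ⟨O, μ, fun A => reduced U (A, μ A), _, _, hOo, hAO,
    hμW.mono fun A hA => (hO A hA).2, ?_, hμ', hΨ', fun X => ?_, fun X => ?_, fun A hA => ?_⟩
  · exact (contDiffOn_reduced U).comp (contDiffOn_id.prodMk (hμW.mono fun A hA => (hO A hA).2))
      fun A hA => (hsol A (hO A hA).2).1
  · change -(β (compression U (shift ((0 : Sym 𝕜 n), (1 : ℝ)))))⁻¹ *
      β (compression U (shift (X, (0 : ℝ)))) = _
    rw [hshift, map_neg, hβ, hβ, inv_neg, neg_neg, shift_apply, zero_smul, sub_zero]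
  · change compression U (shift (X, _)) = _
    rw [shift_apply, map_sub, map_smul, compression_one hU.1]
    rfl
  · obtain ⟨⟨⟨ha, hb⟩, hc⟩, hd⟩ := hO A hA
    have hiff := reduced_eq_zero_iff hU.1 (hsol A hd).1
    have heq : reduced U (A, μ A) = 0 → eigval k A = μ A := fun h => ha ((hiff.1 h).trans hν.symm)
    refine ⟨(hsol A hd).2, ⟨fun h => ?_, fun h => ?_⟩, heq⟩
    · have h0 : reduced U (A, eigval k A) = 0 := (reduced_eq_zero_iff hU.1 hc).2 h
      have : eigval k A = μ A := hb (by simp only [Function.comp_apply]; rw [h0, map_zero])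
      change reduced U (A, μ A) = 0
      rwa [← this]
    · rw [eigmult, eigspace, heq h]
      exact hiff.1 h

/-- Under the nondegeneracy condition the range of the compressed derivative is the orthogonal
complement of `B`. -/
theorem mem_iff_traceForm_eq_zero {V : Submodule ℝ (Sym 𝕜 ν)} {B : Sym 𝕜 ν}
    (h : frobeniusPerp V = Submodule.span ℝ {B}) (X : Sym 𝕜 ν) :
    X ∈ V ↔ traceForm X B = 0 := by
  rw [frobeniusPerp_eq_orthogonal] at h
  have h2 := LinearMap.BilinForm.orthogonal_orthogonal traceForm_nondegenerate
    traceForm_isRefl V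
  rw [← h2, h, traceForm_comm]
  constructor
  · intro hX
    exact hX B (Submodule.mem_span_singleton_self B)
  · intro hX Y hY
    obtain ⟨c, rfl⟩ := Submodule.mem_span_singleton.1 hY
    change traceForm (c • B) X = 0
    rw [map_smul, LinearMap.smul_apply]
    exact smul_eq_zero_of_right c hX

/-- Taking orthogonals twice, `V` is the hyperplane orthogonal to `B`. -/
theorem finrank_eq_stratumCodim {V : Submodule ℝ (Sym 𝕜 ν)} {B : Sym 𝕜 ν} (hB : B ≠ 0)
    (h : frobeniusPerp V = Submodule.span ℝ {B}) :
    Module.finrank ℝ V = stratumCodim 𝕜 ν := by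
  rw [frobeniusPerp_eq_orthogonal] at h
  have h1 := LinearMap.BilinForm.finrank_orthogonal (traceForm_nondegenerate (𝕜 := 𝕜))
    (Submodule.span ℝ {B})
  rwa [← h, LinearMap.BilinForm.orthogonal_orthogonal traceForm_nondegenerate
    traceForm_isRefl, h, finrank_span_singleton hB] at h1

end EigStratum

/-! ### The regular level set theorem with embedded charts. -/

section Submanifold

/-- A surjective linear map is the second coordinate of a linear isomorphism onto a product. -/
theorem ContinuousLinearMap.exists_equiv_prod_of_surjective {E V : Type*}
    [NormedAddCommGroup E] [NormedSpace ℝ E] [FiniteDimensional ℝ E]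
    [NormedAddCommGroup V] [NormedSpace ℝ V] [FiniteDimensional ℝ V] (f : E →L[ℝ] V)
    (hf : Function.Surjective f) :
    ∃ (m : ℕ) (L : E ≃L[ℝ] EuclideanSpace ℝ (Fin m) × V),
      m + Module.finrank ℝ V = Module.finrank ℝ E ∧ ∀ v, (L v).2 = f v := by
  let K := LinearMap.ker f.toLinearMap
  have hdim : Module.finrank ℝ K + Module.finrank ℝ V = Module.finrank ℝ E := by
    rw [← f.toLinearMap.finrank_range_add_finrank_ker, LinearMap.range_eq_top.2 hf, finrank_top,
      add_comm]
  obtain ⟨g, hg⟩ := K.subtype.exists_leftInverse_of_injective (Submodule.ker_subtype K)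
  let i : K ≃L[ℝ] EuclideanSpace ℝ (Fin (Module.finrank ℝ K)) :=
    ContinuousLinearEquiv.ofFinrankEq (by simp)
  let L₀ : E →ₗ[ℝ] EuclideanSpace ℝ (Fin (Module.finrank ℝ K)) × V :=
    (i.toLinearEquiv.toLinearMap ∘ₗ g).prod f.toLinearMap
  have hinj : Function.Injective L₀ := by
    rw [injective_iff_map_eq_zero]
    intro v hv
    have h1 : i (g v) = 0 := congrArg Prod.fst hv
    have h2 : v ∈ K := congrArg Prod.snd hv
    have h3 : g v = ⟨v, h2⟩ := LinearMap.congr_fun hg ⟨v, h2⟩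
    rw [map_eq_zero_iff _ i.injective, h3] at h1
    exact congrArg Subtype.val h1
  exact ⟨_, (L₀.linearEquivOfInjective hinj (by simp [← hdim])).toContinuousLinearEquiv, hdim,
    fun v => rfl⟩

variable {d : ℕ} {M : Type*} [TopologicalSpace M] [ChartedSpace (EuclideanSpace ℝ (Fin d)) M]

/-- If in a chart `φ` the set `S` is the slice where the second component of `L` vanishes, then
`S` is a smooth embedded submanifold. -/
theorem exists_isSmoothEmbedding_of_slice {V : Type*} [NormedAddCommGroup V] [NormedSpace ℝ V]
    {m : ℕ} (L : EuclideanSpace ℝ (Fin d) ≃L[ℝ] EuclideanSpace ℝ (Fin m) × V)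
    {φ : OpenPartialHomeomorph M (EuclideanSpace ℝ (Fin d))}
    (hφ : φ ∈ IsManifold.maximalAtlas (𝓡 d) ∞ M) {S : Set M} (hne : S.Nonempty)
    (hS : ∀ y, y ∈ S ↔ y ∈ φ.source ∧ (L (φ y)).2 = 0) :
    ∃ _ : ChartedSpace (EuclideanSpace ℝ (Fin m)) S, IsManifold (𝓡 m) ∞ S ∧
      Manifold.IsSmoothEmbedding (𝓡 m) (𝓡 d) ∞ (Subtype.val : S → M) := by
  have : Nonempty S := hne.to_subtype
  have hSs : S ⊆ φ.source := fun y hy => ((hS y).1 hy).1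
  let c : S → EuclideanSpace ℝ (Fin m) := fun y => (L (φ y)).1
  let j : EuclideanSpace ℝ (Fin m) → EuclideanSpace ℝ (Fin d) := fun u => L.symm (u, 0)
  have hjc : ∀ y : S, j (c y) = φ y := fun y => by
    have : ((L (φ y)).1, (0 : V)) = L (φ y) := Prod.ext rfl ((hS y).1 y.2).2.symm
    simp only [j, c, this, L.symm_apply_apply]
  have hj : Continuous j := L.symm.continuous.comp (continuous_id.prodMk continuous_const)
  have hφS : Topology.IsEmbedding (fun y : S => φ y) :=
    φ.isOpenEmbedding_restrict.isEmbedding.comp (Topology.IsEmbedding.inclusion hSs)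
  -- Since `j ∘ c` is the restriction of `φ` to `S`, `c` is an embedding; its range is the open set
  -- `j ⁻¹' φ.target`. Thus `c` is a single global chart of `S`.
  have hc : Topology.IsOpenEmbedding c := by
    refine ⟨Topology.IsEmbedding.of_comp ?_ hj ?_, ?_⟩
    · exact continuous_fst.comp (L.continuous.comp hφS.continuous)
    · convert hφS using 1
      exact funext hjc
    · have : Set.range c = j ⁻¹' φ.target := by
        ext u
        constructor
        · rintro ⟨y, rfl⟩
          rw [Set.mem_preimage, hjc]
          exact φ.map_source (hSs y.2)
        · intro hu
          have h1 : φ (φ.symm (j u)) = j u := φ.right_inv hu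
          refine ⟨⟨φ.symm (j u), (hS _).2 ⟨φ.map_target hu, ?_⟩⟩, ?_⟩
          · rw [h1, L.apply_symm_apply]
          · simp only [c, h1, j, L.apply_symm_apply]
      rw [this]
      exact φ.open_target.preimage hj
  let cs : ChartedSpace (EuclideanSpace ℝ (Fin m)) S := hc.singletonChartedSpace
  have hman : IsManifold (𝓡 m) ∞ S := hc.isManifold_singleton
  refine ⟨cs, hman, ?_, Topology.IsEmbedding.subtypeVal⟩
  refine Manifold.IsImmersionOfComplement.isImmersion (F := V) fun y => ?_
  refine Manifold.IsImmersionAtOfComplement.mk_of_continuousAt continuous_subtype_val.continuousAt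
    L.symm (hc.toOpenPartialHomeomorph c) φ (by simp) (hSs y.2)
    (IsManifold.subset_maximalAtlas rfl) hφ ?_
  intro u hu
  have hu' : u ∈ Set.range c := by simpa using hu
  obtain ⟨z, rfl⟩ := hu'
  have hz : (hc.toOpenPartialHomeomorph c).symm (c z) = z :=
    (hc.toOpenPartialHomeomorph c).left_inv (by simp)
  simp only [Function.comp_apply, OpenPartialHomeomorph.extend_coe,
    OpenPartialHomeomorph.extend_coe_symm, modelWithCornersSelf_coe, modelWithCornersSelf_coe_symm,
    id_eq, hz]
  exact (hjc z).symm

/-- The regular level set theorem: near a point where `Ψ` vanishes and has a surjective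
differential, the zero set of `Ψ` is a smooth embedded submanifold. -/
theorem exists_isSmoothEmbedding_zeroSet [IsManifold (𝓡 d) ∞ M] {V : Type*}
    [NormedAddCommGroup V] [NormedSpace ℝ V] [FiniteDimensional ℝ V] {Ψ : M → V} {O : Set M}
    (hO : IsOpen O) (hΨ : ContMDiffOn (𝓡 d) 𝓘(ℝ, V) ∞ Ψ O) {x : M} (hx : x ∈ O) (hx0 : Ψ x = 0)
    (hsurj : Function.Surjective (mfderiv (𝓡 d) 𝓘(ℝ, V) Ψ x)) :
    ∃ (W : Set M) (m : ℕ), IsOpen W ∧ x ∈ W ∧ W ⊆ O ∧ m + Module.finrank ℝ V = d ∧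
      ∃ _ : ChartedSpace (EuclideanSpace ℝ (Fin m)) {y | y ∈ W ∧ Ψ y = 0},
        IsManifold (𝓡 m) ∞ {y | y ∈ W ∧ Ψ y = 0} ∧
        Manifold.IsSmoothEmbedding (𝓡 m) (𝓡 d) ∞
          (Subtype.val : {y | y ∈ W ∧ Ψ y = 0} → M) := by
  let χ := chartAt (EuclideanSpace ℝ (Fin d)) x
  have hχ : χ ∈ IsManifold.maximalAtlas (𝓡 d) ∞ M := IsManifold.chart_mem_maximalAtlas x
  have hxχ : x ∈ χ.source := mem_chart_source _ x
  let Ω : Set (EuclideanSpace ℝ (Fin d)) := χ.target ∩ χ.symm ⁻¹' O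
  have hΩ : IsOpen Ω := χ.symm.isOpen_inter_preimage hO
  have hxΩ : χ x ∈ Ω := ⟨χ.map_source hxχ, by simpa [χ.left_inv hxχ] using hx⟩
  let f : EuclideanSpace ℝ (Fin d) → V := Ψ ∘ χ.symm
  have hf : ContDiffOn ℝ ∞ f Ω := by
    rw [← contMDiffOn_iff_contDiffOn]
    exact hΨ.comp ((contMDiffOn_symm_of_mem_maximalAtlas hχ).mono Set.inter_subset_left)
      fun y hy => hy.2
  have hd : DifferentiableAt ℝ f (χ x) :=
    (hf.contDiffAt (hΩ.mem_nhds hxΩ)).differentiableAt (by simp)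
  have hmd : MDifferentiableAt (𝓡 d) 𝓘(ℝ, V) Ψ x :=
    (hΨ.contMDiffAt (hO.mem_nhds hx)).mdifferentiableAt (by simp)
  have hsurj' : Function.Surjective (fderiv ℝ f (χ x)) := by
    rw [hmd.mfderiv] at hsurj
    simp only [mfld_simps, writtenInExtChartAt, extChartAt, fderivWithin_univ] at hsurj
    exact hsurj
  obtain ⟨m, L, hm, hL⟩ := (fderiv ℝ f (χ x)).exists_equiv_prod_of_surjective hsurj'
  -- Replacing the `V`-coordinate by `f` straightens the zero set. As that coordinate of `L` is the
  -- derivative of `f` at `χ x`, the derivative of `θ` there is the identity.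
  let θ : EuclideanSpace ℝ (Fin d) → EuclideanSpace ℝ (Fin d) :=
    fun y => L.symm ((L y).1, f y)
  have hθ : ContDiffOn ℝ ∞ θ Ω :=
    L.symm.contDiff.comp_contDiffOn
      (((contDiff_fst.comp L.contDiff).contDiffOn).prodMk hf)
  have hθ' : HasFDerivAt θ ((ContinuousLinearEquiv.refl ℝ (EuclideanSpace ℝ (Fin d)) :
      EuclideanSpace ℝ (Fin d) ≃L[ℝ] EuclideanSpace ℝ (Fin d)) :
      EuclideanSpace ℝ (Fin d) →L[ℝ] EuclideanSpace ℝ (Fin d)) (χ x) := by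
    have h1 : HasFDerivAt (fun y => ((L y).1, f y))
        ((ContinuousLinearMap.fst ℝ (EuclideanSpace ℝ (Fin m)) V ∘L L.toContinuousLinearMap).prod
          (fderiv ℝ f (χ x))) (χ x) :=
      (ContinuousLinearMap.hasFDerivAt
        (ContinuousLinearMap.fst ℝ (EuclideanSpace ℝ (Fin m)) V ∘L
          L.toContinuousLinearMap)).prodMk hd.hasFDerivAt
    refine (L.symm.hasFDerivAt.comp (χ x) h1).congr_fderiv ?_
    refine ContinuousLinearMap.ext fun v => ?_
    change L.symm ((L v).1, fderiv ℝ f (χ x) v) = v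
    rw [← hL, L.symm_apply_apply]
  obtain ⟨e, hxe, heΩ, heθ, hes, het⟩ := hθ.exists_openPartialHomeomorph hΩ hxΩ hθ'
  let φ := χ.trans e
  have hφs : ∀ y, y ∈ φ.source ↔ y ∈ χ.source ∧ χ y ∈ e.source := fun y => by
    simp [φ]
  have hφ : φ ∈ IsManifold.maximalAtlas (𝓡 d) ∞ M := by
    apply OpenPartialHomeomorph.mem_maximalAtlas_of_contMDiffOn
    · exact hes.contMDiffOn.comp ((contMDiffOn_of_mem_maximalAtlas hχ).mono
        fun y hy => ((hφs y).1 hy).1) fun y hy => ((hφs y).1 hy).2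
    · refine (contMDiffOn_symm_of_mem_maximalAtlas hχ).comp (het.contMDiffOn.mono ?_) ?_
      · intro y hy
        simp only [φ, OpenPartialHomeomorph.trans_target] at hy
        exact hy.1
      · intro y hy
        simp only [φ, OpenPartialHomeomorph.trans_target] at hy
        exact hy.2
  have hW : ∀ y ∈ φ.source, y ∈ O ∧ (L (φ y)).2 = Ψ y := fun y hy => by
    obtain ⟨h1, h2⟩ := (hφs y).1 hy
    refine ⟨by simpa [χ.left_inv h1] using (heΩ h2).2, ?_⟩
    have : φ y = θ (χ y) := congrFun heθ (χ y)
    rw [this]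
    simp only [θ, f, L.apply_symm_apply, Function.comp_apply, χ.left_inv h1]
  have hxφ : x ∈ φ.source := (hφs x).2 ⟨hxχ, hxe⟩
  refine ⟨φ.source, m, φ.open_source, hxφ, fun y hy => (hW y hy).1, by simpa using hm, ?_⟩
  refine exists_isSmoothEmbedding_of_slice L hφ ⟨x, hxφ, hx0⟩ fun y => ?_
  exact and_congr_right fun hy => by rw [(hW y hy).2]

end Submanifold

end

/-! ### Pulling the local equations back to the manifold. -/

theorem mainTheorem5 {𝕜 : Type*} [RCLike 𝕜] {n d : ℕ} {M : Type*} [TopologicalSpace M]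
    [ChartedSpace (EuclideanSpace ℝ (Fin d)) M] [IsManifold (𝓡 d) ∞ M]
    (F : M → EigStratum.Sym 𝕜 n) (hF : ContMDiff (𝓡 d) 𝓘(ℝ, EigStratum.Sym 𝕜 n) ∞ F)
    (k : Fin n) (ν : ℕ) (x : M) (hν : EigStratum.eigmult k (F x) = ν)
    (hN : EigStratum.ConditionN (d := d) F k ν x) :
    ∃ (S : Set M) (m : ℕ) (_ : ChartedSpace (EuclideanSpace ℝ (Fin m)) S),
      IsManifold (𝓡 m) ∞ S ∧
      Manifold.IsSmoothEmbedding (𝓡 m) (𝓡 d) ∞ (Subtype.val : S → M) ∧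
      (∀ᶠ y in 𝓝 x, EigStratum.eigmult k (F y) = ν ↔ y ∈ S) ∧
      m + EigStratum.stratumCodim 𝕜 ν = d ∧
      ContMDiff (𝓡 m) 𝓘(ℝ, ℝ) ∞ (fun y : S => EigStratum.eigval k (F y)) ∧
      ∃ hx : x ∈ S,
        mfderiv (𝓡 m) 𝓘(ℝ, ℝ) (fun y : S => EigStratum.eigval k (F y)) ⟨x, hx⟩ = 0 := by
  obtain ⟨U, hU, B, hB, hperp⟩ := hN
  obtain ⟨O, μ, Ψ, μ', Ψ', hO, hxO, hμ, hΨ, hμ', hΨ', hμ'eq, hΨ'eq, hloc⟩ :=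
    EigStratum.exists_local_equation k (F x) hν hU hB
  set R := LinearMap.range (EigStratum.compressedDeriv (d := d) F x U)
  have hB0 : B ≠ 0 := by
    rintro rfl
    have := EigStratum.traceForm_one_pos (hν ▸ EigStratum.eigmult_pos k (F x)) hB
    simp at this
  have hRmem := EigStratum.mem_iff_traceForm_eq_zero hperp
  -- `Ψ` takes values in `R`, a proper subspace of `Sym`. Composing with a retraction onto `R` makes
  -- surjectivity of the differential possible and leaves the zeros over `O` unchanged.
  obtain ⟨q₀, hq₀⟩ := R.subtype.exists_leftInverse_of_injective (Submodule.ker_subtype R)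
  let q : EigStratum.Sym 𝕜 ν →L[ℝ] R := q₀.toContinuousLinearMap
  have hq : ∀ X : R, q X = X := fun X => LinearMap.congr_fun hq₀ X
  have hq0 : ∀ X ∈ R, q X = 0 ↔ X = 0 := fun X hX => by
    rw [hq ⟨X, hX⟩, Submodule.mk_eq_zero]
  have hFd : HasMFDerivAt (𝓡 d) 𝓘(ℝ, EigStratum.Sym 𝕜 n) F x
      (mfderiv (𝓡 d) 𝓘(ℝ, EigStratum.Sym 𝕜 n) F x) :=
    (hF.contMDiffAt.mdifferentiableAt (by simp)).hasMFDerivAt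
  -- This is the criticality: `μ'` is proportional to the pairing of the compression with `B`, which
  -- vanishes on the range of `H_x`.
  have hμ'0 : ∀ v : TangentSpace (𝓡 d) x,
      μ' (mfderiv (𝓡 d) 𝓘(ℝ, EigStratum.Sym 𝕜 n) F x v) = 0 := fun v =>
    (hμ'eq _).trans (mul_eq_zero_of_right _ ((hRmem _).1 ⟨v, rfl⟩))
  have hΨ'0 : ∀ X, μ' X = 0 → Ψ' X = EigStratum.compression U X := fun X hX => by
    rw [hΨ'eq, hX, zero_smul, sub_zero]
  have hO' : IsOpen (F ⁻¹' O) := hO.preimage hF.continuous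
  have hqΨ : HasFDerivAt (fun A => q (Ψ A)) (q ∘L Ψ') (F x) := q.hasFDerivAt.comp (F x) hΨ'
  have hΦd : mfderiv (𝓡 d) 𝓘(ℝ, R) (fun y => q (Ψ (F y))) x =
      (q ∘L Ψ') ∘L mfderiv (𝓡 d) 𝓘(ℝ, EigStratum.Sym 𝕜 n) F x :=
    (hqΨ.hasMFDerivAt.comp x hFd).mfderiv
  have hzero : ∀ y ∈ F ⁻¹' O, q (Ψ (F y)) = 0 ↔ Ψ (F y) = 0 := fun y hy =>
    hq0 _ ((hRmem _).2 (hloc _ hy).1)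
  obtain ⟨W, m, hW, hxW, hWO, hm, cs, hman, hemb⟩ :=
    exists_isSmoothEmbedding_zeroSet (Ψ := fun y => q (Ψ (F y))) hO'
      ((q.contDiff.comp_contDiffOn hΨ).contMDiffOn.comp hF.contMDiffOn fun y hy => hy) hxO
      ((hzero x hxO).2 ((hloc _ hxO).2.1.1 hν)) (by
        rw [hΦd]
        rintro ⟨_, v, rfl⟩
        -- Because `μ'` vanishes on the range of `dF`, `Ψ'` acts there as the compression, so the
        -- differential is `H_x` onto its own range.
        exact ⟨v, (congrArg q (hΨ'0 _ (hμ'0 v))).trans (hq ⟨_, v, rfl⟩)⟩)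
  have hxS : x ∈ {y | y ∈ W ∧ q (Ψ (F y)) = 0} :=
    ⟨hxW, (hzero x hxO).2 ((hloc _ hxO).2.1.1 hν)⟩
  have heig : (fun y : {y | y ∈ W ∧ q (Ψ (F y)) = 0} => EigStratum.eigval k (F y)) =
      (fun y => μ (F y)) ∘ Subtype.val := funext fun y =>
    (hloc _ (hWO y.2.1)).2.2 ((hzero _ (hWO y.2.1)).1 y.2.2)
  refine ⟨{y | y ∈ W ∧ q (Ψ (F y)) = 0}, m, cs, hman, hemb, ?_, ?_, ?_, hxS, ?_⟩
  · filter_upwards [hW.mem_nhds hxW] with y hy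
    rw [(hloc _ (hWO hy)).2.1, ← hzero y (hWO hy)]
    exact ⟨fun h => ⟨hy, h⟩, fun h => h.2⟩
  · rw [← EigStratum.finrank_eq_stratumCodim hB0 hperp]
    exact hm
  · rw [heig]
    exact (hμ.contMDiffOn.comp hF.contMDiffOn fun y hy => hy).comp_contMDiff hemb.contMDiff
      fun y => hWO y.2.1
  · rw [heig]
    have hval : HasMFDerivAt (𝓡 m) (𝓡 d) (Subtype.val : {y | y ∈ W ∧ q (Ψ (F y)) = 0} → M)
        ⟨x, hxS⟩ _ :=
      (hemb.contMDiff.contMDiffAt.mdifferentiableAt (by simp)).hasMFDerivAt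
    have hμF : HasMFDerivAt (𝓡 d) 𝓘(ℝ, ℝ) (fun y => μ (F y)) x _ := hμ'.hasMFDerivAt.comp x hFd
    rw [(HasMFDerivAt.comp (⟨x, hxS⟩ : {y | y ∈ W ∧ q (Ψ (F y)) = 0}) hμF hval).mfderiv]
    refine ContinuousLinearMap.ext fun v => ?_
    exact hμ'0 _
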